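/- Let $A$ be a field, ${\mathcal D}(A)$ a commutative $A$-algebra with an $A$-basis $(\epsilon_0,\dots,\epsilon_{\ell-1})$, and $\pi:{\mathcal D}(A)\to A$ an $A$-algebra homomorphism with $\pi(\epsilon_0)=1$ and $\pi(\epsilon_j)=0$ for $j\ge 1$. Write ${\mathcal D}(A)=\prod_{i=0}^t B_i$ with $B_i$ local $A$-algebras, labelled so that $B_0$ corresponds to the maximal ideal $\ker\pi$, and assume that the residue field of every $B_i$ is $A$. Let $\pi_i:{\mathcal D}(A)\to B_i\to A$ be the induced homomorphisms (so $\pi_0=\pi$). For an $A$-algebra $R$ put ${\mathcal D}(R)=R\otimes_A{\mathcal D}(A)$, and write $\pi_i$ also for the induced map ${\mathcal D}(R)\to R$. A ${\mathcal D}$-ring is an $A$-algebra $R$ with operators $\partial=(\partial_1,\dots,\partial_{\ell-1})$ on $R$ such that $e(r)=r\epsilon_0+\partial_1(r)\epsilon_1+\cdots+\partial_{\ell-1}(r)\epsilon_{\ell-1}$ defines an $A$-algebra homomorphism $e:R\to{\mathcal D}(R)$. Put $\sigma_i=\pi_i\circ e:R\to R$ for $i=0,\dots,t$ (so $\sigma_0=\mathrm{id}$);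 $\sigma_1,\dots,\sigma_t$ are the associated endomorphisms, and $(R,\partial)$ is inversive if they are all surjective. Let ${\mathcal K}$ be the class of ${\mathcal D}$-rings $(R,\partial)$ such that $R$ is an integral domain of characteristic zero and $\sigma_1,\dots,\sigma_t$ are injective. In the language $\{0,1,+,-,\times,(\lambda_a)_{a\in A},\partial_1,\dots,\partial_{\ell-1}\}$, where $\lambda_a$ is scalar multiplication by $a$, a member $(K,\partial)$ of ${\mathcal K}$ is existentially closed if every quantifier-free formula with parameters from $K$ that has a solution in some extension of $(K,\partial)$ in ${\mathcal K}$ has a solution in $(K,\partial)$. For a closed subscheme $X\subseteq\mathbb A^n_K$ with ideal $I\subseteq K[x]$, $x=(x_1,\dots,x_n)$, the prolongation $\tau X\subseteq\mathbb A^{n\ell}_K$ is the closed subscheme whose ideal is generated by the polynomials $P^{(0)},\dots,P^{(\ell-1)}\in K[x^{(0)},\dots,x^{(\ell-1)}]$, $P\in I$, where $P^e\big(\sum_j x^{(j)}\epsilon_j\big)=\sum_j P^{(j)}\epsilon_j$ and $P^e$ is obtained by applying $e$ to the coefficients of $P$. Let $X^{\sigma_i}$ be obtained by applying $\sigma_i$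 to the coefficients of the polynomials in $I$, let $\widehat{\pi_i}:\tau X\to X^{\sigma_i}$ be the morphism $(x^{(j)})_j\mapsto\pi_i\big(\sum_j x^{(j)}\epsilon_j\big)=\sum_j\pi_i(\epsilon_j)x^{(j)}$, and for $a\in X(K)$ let $\nabla(a)=(a,\partial_1(a),\dots,\partial_{\ell-1}(a))\in\tau X(K)$. **Theorem.** Let $(K,\partial)\in{\mathcal K}$. Then $(K,\partial)$ is existentially closed in ${\mathcal K}$ if and only if (I) $K$ is an algebraically closed field; (II) $(K,\partial)$ is inversive; and (III) whenever $X$ is an irreducible affine variety over $K$ and $Y\subseteq\tau X$ is an irreducible closed subvariety over $K$ such that $\widehat{\pi_i}(Y)$ is Zariski dense in $X^{\sigma_i}$ for all $i=0,\dots,t$, there exists $a\in X(K)$ with $\nabla(a)\in Y(K)$. -/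

import Mathlib

open scoped TensorProduct

universe u v w z

/-- The basic data over a base ring `A`: a finite free commutative `A`-algebra `alg`, with an
`A`-algebra homomorphism `π` to `A` and an `A`-basis `ε 0, …, ε m` such that `π (ε 0) = 1` and
`π (ε i) = 0` for `i = 1, …, m`. -/
structure OperatorData (A : Type u) [CommRing A] where
  alg : Type v
  [commRing : CommRing alg]
  [algebra : Algebra A alg]
  m : ℕ
  ε : Module.Basis (Fin (m + 1)) A alg
  π : alg →ₐ[A] A
  π_zero : π (ε 0) = 1
  π_succ : ∀ i : Fin m, π (ε i.succ) = 0

attribute [instance] OperatorData.commRing OperatorData.algebra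

/-- A decomposition of the `A`-algebra `𝒟.alg` as a product of local `A`-algebras
`B 0, …, B t`, all of which have residue field `A`. The factors are labelled so that
`B 0` is the one that corresponds to the maximal ideal `ker π`. -/
structure LocalSplitting {A : Type u} [Field A] (𝒟 : OperatorData.{u, v} A) where
  t : ℕ
  B : Fin (t + 1) → Type w
  [commRing : ∀ i, CommRing (B i)]
  [isLocalRing : ∀ i, IsLocalRing (B i)]
  [algebra : ∀ i, Algebra A (B i)]
  split : 𝒟.alg ≃ₐ[A] (∀ i, B i)
  residue_bijective : ∀ i,
    Function.Bijective (algebraMap A (IsLocalRing.ResidueField (B i)))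
  residue_zero : ∀ d : 𝒟.alg,
    IsLocalRing.residue (B 0) (split d 0) = algebraMap A _ (𝒟.π d)

attribute [instance] LocalSplitting.commRing LocalSplitting.isLocalRing LocalSplitting.algebra

/-- A `𝒟`-ring structure on the `A`-algebra `R`: operators `∂_1, …, ∂_m` such that
`e r = r ε_0 + ∂_1 r ε_1 + ⋯ + ∂_m r ε_m` is an `A`-algebra homomorphism
`R → 𝒟(R) = R ⊗[A] 𝒟(A)`. Here `∂_(i+1)` is `op i`. -/
class DRing {A : Type u} [CommRing A] (𝒟 : OperatorData.{u, v} A)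
    (R : Type z) [CommRing R] [Algebra A R] where
  op : Fin 𝒟.m → R → R
  e : R →ₐ[A] R ⊗[A] 𝒟.alg
  e_apply : ∀ r : R, e r = r ⊗ₜ[A] 𝒟.ε 0 + ∑ i : Fin 𝒟.m, op i r ⊗ₜ[A] 𝒟.ε i.succ

namespace OperatorData

variable {A : Type u} [CommRing A] (𝒟 : OperatorData.{u, v} A)

/-- The function symbols of the language of `𝒟`-rings
`{0, 1, +, -, ×, (λ_a)_{a ∈ A}, ∂_1, …, ∂_m}`. -/
inductive Func (A : Type u) (m : ℕ) : ℕ → Type u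
  | zero : Func A m 0
  | one : Func A m 0
  | add : Func A m 2
  | neg : Func A m 1
  | mul : Func A m 2
  | smul (a : A) : Func A m 1
  | op (i : Fin m) : Func A m 1

/-- The first-order language of `𝒟`-rings; it has no relation symbols besides equality. -/
def lang : FirstOrder.Language.{u, 0} where
  Functions := Func A 𝒟.m
  Relations := fun _ => Empty

/-- A `𝒟`-ring as a first-order structure. -/
instance instStructure (R : Type z) [CommRing R] [Algebra A R] [DRing 𝒟 R] :
    𝒟.lang.Structure R where
  funMap := fun f x =>
    match f, x with
    | .zero, _ => 0
    | .one, _ => 1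
    | .add, x => x 0 + x 1
    | .neg, x => -x 0
    | .mul, x => x 0 * x 1
    | .smul a, x => a • x 0
    | .op i, x => DRing.op (𝒟 := 𝒟) i (x 0)
  RelMap := fun r _ => nomatch r

/-- The map `∇ : Rⁿ → R^{n(m+1)}`, `∇ a = (a, ∂_1 a, …, ∂_m a)`. The coordinate `(k, j)` is
`∂_j (a_k)`, where `∂_0 = id`. -/
def nabla {R : Type z} [CommRing R] [Algebra A R] [DRing 𝒟 R] {n : ℕ} (a : Fin n → R) :
    Fin n × Fin (𝒟.m + 1) → R :=
  fun p => Fin.cons (α := fun _ => R) (a p.1) (fun i => DRing.op (𝒟 := 𝒟) i (a p.1)) p.2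

/-- The element `∑_j x_k^{(j)} ε_j` of `R[x^{(0)}, …, x^{(m)}] ⊗[A] 𝒟(A)`. The variable
`x_k^{(j)}` is `X (k, j)`. -/
noncomputable def genericPoint (R : Type z) [CommRing R] [Algebra A R] {n : ℕ} (k : Fin n) :
    MvPolynomial (Fin n × Fin (𝒟.m + 1)) R ⊗[A] 𝒟.alg :=
  ∑ j : Fin (𝒟.m + 1), MvPolynomial.X (k, j) ⊗ₜ[A] 𝒟.ε j

/-- `P^e (∑_j x^{(j)} ε_j)`: the coefficients of `P` are mapped by `e`, and `∑_j x_k^{(j)} ε_j`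
is substituted for the variable `x_k`. -/
noncomputable def prolongPoly {R : Type z} [CommRing R] [Algebra A R] [DRing 𝒟 R] {n : ℕ}
    (P : MvPolynomial (Fin n) R) :
    MvPolynomial (Fin n × Fin (𝒟.m + 1)) R ⊗[A] 𝒟.alg :=
  P.eval₂
    (((Algebra.TensorProduct.map
        (IsScalarTower.toAlgHom A R (MvPolynomial (Fin n × Fin (𝒟.m + 1)) R))
        (AlgHom.id A 𝒟.alg)).comp (DRing.e (𝒟 := 𝒟) (R := R))).toRingHom)
    (𝒟.genericPoint R)

/-- `P^{(j)}`: the coefficient of `ε_j` in `P^e (∑_j x^{(j)} ε_j)`. -/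
noncomputable def prolongCoeff {R : Type z} [CommRing R] [Algebra A R] [DRing 𝒟 R] {n : ℕ}
    (P : MvPolynomial (Fin n) R) (j : Fin (𝒟.m + 1)) :
    MvPolynomial (Fin n × Fin (𝒟.m + 1)) R :=
  (𝒟.ε.baseChange (MvPolynomial (Fin n × Fin (𝒟.m + 1)) R)).repr (𝒟.prolongPoly P) j

/-- The ideal of the prolongation `τ X`, where `X` is the closed subscheme of affine `n`-space
over `R` with ideal `I`: it is generated by all `P^{(j)}` with `P ∈ I`. -/
noncomputable def prolongIdeal {R : Type z} [CommRing R] [Algebra A R] [DRing 𝒟 R] {n : ℕ}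
    (I : Ideal (MvPolynomial (Fin n) R)) :
    Ideal (MvPolynomial (Fin n × Fin (𝒟.m + 1)) R) :=
  Ideal.span {Q | ∃ P ∈ I, ∃ j, Q = 𝒟.prolongCoeff P j}

end OperatorData

namespace LocalSplitting

variable {A : Type u} [Field A] {𝒟 : OperatorData.{u, v} A} (S : LocalSplitting.{u, v, w} 𝒟)

/-- `π_i : 𝒟(A) → A`: projection to `B_i`, followed by the residue map `B_i → A`. -/
noncomputable def pi (i : Fin (S.t + 1)) : 𝒟.alg →ₐ[A] A :=
  ((AlgEquiv.ofBijective (Algebra.ofId A (IsLocalRing.ResidueField (S.B i)))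
      (S.residue_bijective i)).symm : IsLocalRing.ResidueField (S.B i) →ₐ[A] A).comp
    ((IsScalarTower.toAlgHom A (S.B i) (IsLocalRing.ResidueField (S.B i))).comp
      ((Pi.evalAlgHom A S.B i).comp (S.split : 𝒟.alg →ₐ[A] (∀ i, S.B i))))

/-- `π_i^R = id ⊗ π_i : 𝒟(R) → R`. -/
noncomputable def piBase (R : Type z) [CommRing R] [Algebra A R] (i : Fin (S.t + 1)) :
    R ⊗[A] 𝒟.alg →ₐ[R] R :=
  (Algebra.TensorProduct.rid A R R : R ⊗[A] A →ₐ[R] R).comp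
    (Algebra.TensorProduct.map (AlgHom.id R R) (S.pi i))

/-- `σ_i = π_i^R ∘ e : R → R`. The associated endomorphisms are `σ_1, …, σ_t`. -/
noncomputable def σ (R : Type z) [CommRing R] [Algebra A R] [DRing 𝒟 R]
    (i : Fin (S.t + 1)) : R →ₐ[A] R :=
  ((S.piBase R i).restrictScalars A).comp (DRing.e (𝒟 := 𝒟) (R := R))

/-- Membership in the class `𝒦`: integral domains of characteristic zero with injective
associated endomorphisms. -/
structure InClass (R : Type z) [CommRing R] [Algebra A R] [DRing 𝒟 R] : Prop where
  isDomain : IsDomain R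
  charZero : CharZero R
  injective : ∀ i : Fin S.t, Function.Injective (S.σ R i.succ)

/-- `(K, ∂)` is existentially closed in the class `𝒦`: every quantifier-free formula with
parameters from `K` that has a solution in some extension of `(K, ∂)` in `𝒦` has a solution
in `(K, ∂)`. -/
def IsExistentiallyClosed (K : Type z) [CommRing K] [Algebra A K] [DRing 𝒟 K] : Prop :=
  ∀ (L : Type z) [CommRing L] [Algebra A L] [DRing 𝒟 L], S.InClass L →
    ∀ (f : 𝒟.lang.Embedding K L) (r n : ℕ) (φ : 𝒟.lang.Formula (Fin r ⊕ Fin n)), φ.IsQF →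
      ∀ c : Fin r → K, (∃ x : Fin n → L, φ.Realize (Sum.elim (f ∘ c) x)) →
        ∃ x : Fin n → K, φ.Realize (Sum.elim c x)

/-- `(R, ∂)` is inversive: the associated endomorphisms are surjective. -/
def IsInversive (R : Type z) [CommRing R] [Algebra A R] [DRing 𝒟 R] : Prop :=
  ∀ i : Fin S.t, Function.Surjective (S.σ R i.succ)

/-- The ideal of `X^{σ_i}`, where `X` has the ideal `I`: apply `σ_i` to the coefficients. -/
noncomputable def conjIdeal {R : Type z} [CommRing R] [Algebra A R] [DRing 𝒟 R] {n : ℕ}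
    (i : Fin (S.t + 1)) (I : Ideal (MvPolynomial (Fin n) R)) :
    Ideal (MvPolynomial (Fin n) R) :=
  I.map (MvPolynomial.map (S.σ R i : R →+* R))

/-- The morphism `π̂_i : τ X → X^{σ_i}`, which on points is
`π_i : X(𝒟(R)) → X^{σ_i}(R)`, on the level of the polynomial rings of the ambient affine
spaces: `x_k ↦ π_i (∑_j x_k^{(j)} ε_j) = ∑_j π_i(ε_j) x_k^{(j)}`. -/
noncomputable def piHat (R : Type z) [CommRing R] [Algebra A R] (n : ℕ)
    (i : Fin (S.t + 1)) :
    MvPolynomial (Fin n) R →ₐ[R] MvPolynomial (Fin n × Fin (𝒟.m + 1)) R :=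
  MvPolynomial.aeval fun k =>
    S.piBase (MvPolynomial (Fin n × Fin (𝒟.m + 1)) R) i (𝒟.genericPoint R k)

/-- The geometric axiom. An irreducible affine variety `X` is given by a prime ideal `I` of
`K[x_1, …, x_n]`, and an irreducible closed subvariety `Y` of `τ X` by a prime ideal `J` that
contains the ideal of `τ X`. If, for `i = 0, …, t`, the image of `Y` under `π̂_i` is Zariski
dense in `X^{σ_i}`, then there is `a ∈ X(K)` with `∇ a ∈ Y(K)`. -/
def GeometricAxiom (K : Type z) [CommRing K] [Algebra A K] [DRing 𝒟 K] : Prop :=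
  ∀ (n : ℕ) (I : Ideal (MvPolynomial (Fin n) K))
    (J : Ideal (MvPolynomial (Fin n × Fin (𝒟.m + 1)) K)),
    I.IsPrime → J.IsPrime → 𝒟.prolongIdeal I ≤ J →
    (∀ i : Fin (S.t + 1),
      closure (PrimeSpectrum.comap (S.piHat K n i).toRingHom '' PrimeSpectrum.zeroLocus J) =
        PrimeSpectrum.zeroLocus (S.conjIdeal i I : Set (MvPolynomial (Fin n) K))) →
    ∃ a : Fin n → K,
      (∀ P ∈ I, MvPolynomial.eval a P = 0) ∧
      (∀ Q ∈ J, MvPolynomial.eval (𝒟.nabla a) Q = 0)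

end LocalSplitting

/-- `K` is an algebraically closed field. -/
def IsAlgClosedField (K : Type z) [CommRing K] : Prop :=
  ∃ h : IsField K, letI := h.toField; IsAlgClosed K

open FirstOrder FirstOrder.Language MvPolynomial

/-! The kernel of `(π_0, …, π_t) : 𝒟(Ω) → Ω^(t+1)` is nilpotent, and in characteristic zero a domain
`R` is formally smooth under every field `Ω` containing it. So a homomorphism `e : R → 𝒟(Ω)` lifting
the inclusion extends to a `𝒟`-structure on `Ω` as soon as each `π_i ∘ e : R → Ω` extends to an
endomorphism of `Ω` (`exists_dring_extending`). Building extensions in `𝒦` thus becomes a question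
about embeddings of fields.

If `K` is existentially closed, three such extensions give the axioms. The algebraic closure of the
fraction field gives (I). For (II), if `c ∉ σ_i(K)`, then `c` is transcendental over the
algebraically closed field `σ_i(K)`, so `K[X]` can be given `σ_i(X) = c`. For (III), a generic point
`b` of `Y` defines `e : K[X] → 𝒟(Ω)`, `P ↦ P^e(b)`; density makes every `π_i ∘ e` injective, and
finite transcendence degree over `K`, together with inversivity, extends these maps to `Ω`. The
generic point of `X` then has `∇` equal to `b`.

Conversely, let `a` be a tuple in an extension, `X` its locus over `K` and `Y` the locus of `∇ a`.
Injectivity of the `σ_i` yields the density in (III), so some `a'` in `K` satisfies all algebraic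
relations of `∇ a`. If `a` lists enough elements, including inverses of nonzero differences, the
specialization `a ↦ a'` preserves a given quantifier-free formula. -/

/-! ### Formal smoothness and embeddings of fields -/

/-- `L` is algebraic, hence separable, over a purely transcendental extension of `K`. -/
theorem Algebra.FormallySmooth.of_charZero (K L : Type*) [Field K] [Field L] [Algebra K L]
    [CharZero K] : Algebra.FormallySmooth K L := by
  obtain ⟨s, hs⟩ := exists_isTranscendenceBasis K L
  have := hs.isAlgebraic_field
  exact .of_algebraicIndependent_of_isSeparable hs.1

/-- A domain of characteristic zero is formally smooth under every field that contains it. -/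
theorem RingHom.formallySmooth_of_charZero {R L : Type*} [CommRing R] [IsDomain R] [CharZero R]
    [Field L] (j : R →+* L) (hj : Function.Injective j) : j.FormallySmooth := by
  let := j.toAlgebra
  have : FaithfulSMul R L := (faithfulSMul_iff_algebraMap_injective R L).2 hj
  let := FractionRing.liftAlgebra R L
  have := FractionRing.isScalarTower_liftAlgebra R L
  have : Algebra.FormallySmooth R (FractionRing R) :=
    .of_isLocalization (nonZeroDivisors R)
  have : CharZero (FractionRing R) :=
    charZero_of_injective_algebraMap (IsFractionRing.injective R (FractionRing R))
  have : Algebra.FormallySmooth (FractionRing R) L := .of_charZero _ _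
  exact Algebra.FormallySmooth.comp R (FractionRing R) L

/-- Lifting of a commutative square against a surjection with nilpotent kernel. -/
theorem RingHom.FormallySmooth.exists_lift {R Ω T P : Type*} [CommRing R] [CommRing Ω]
    [CommRing T] [CommRing P] {j : R →+* Ω} (hj : j.FormallySmooth) (e : R →+* T) (q : T →+* P)
    (hq : Function.Surjective q) (hq' : IsNilpotent (RingHom.ker q)) (τ : Ω →+* P)
    (h : q.comp e = τ.comp j) : ∃ E : Ω →+* T, E.comp j = e ∧ q.comp E = τ := by
  let := j.toAlgebra
  let := e.toAlgebra
  let := (q.comp e).toAlgebra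
  have : Algebra.FormallySmooth R Ω := hj
  let q' : T →ₐ[R] P := { q with commutes' := fun _ => rfl }
  let τ' : Ω →ₐ[R] P := { τ with commutes' := fun r => (RingHom.congr_fun h r).symm }
  refine ⟨(Algebra.FormallySmooth.liftOfSurjective τ' q' hq hq' : Ω →ₐ[R] T), ?_, ?_⟩
  · exact AlgHom.comp_algebraMap _
  · ext x
    exact Algebra.FormallySmooth.liftOfSurjective_apply τ' q' hq hq' x

/-- A transcendence basis of `Ω₁` is sent injectively into one of `Ω₂`; what remains is algebraic
and extends because `Ω₂` is algebraically closed. -/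
theorem exists_algHom_of_trdeg_le {R : Type u} {Ω₁ Ω₂ : Type z} [CommRing R] [IsDomain R]
    [Field Ω₁] [Field Ω₂] [Algebra R Ω₁] [Algebra R Ω₂] [FaithfulSMul R Ω₁] [FaithfulSMul R Ω₂]
    [IsAlgClosed Ω₂] (h : Algebra.trdeg R Ω₁ ≤ Algebra.trdeg R Ω₂) :
    Nonempty (Ω₁ →ₐ[R] Ω₂) := by
  obtain ⟨s, hs⟩ := exists_isTranscendenceBasis R Ω₁
  obtain ⟨t, ht⟩ := exists_isTranscendenceBasis R Ω₂
  rw [← hs.cardinalMk_eq_trdeg, ← ht.cardinalMk_eq_trdeg] at h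
  obtain ⟨g⟩ := h
  let S := Algebra.adjoin R (Set.range ((↑) : s → Ω₁))
  have hy : AlgebraicIndependent R (fun i => (g i : Ω₂)) := ht.1.comp g g.injective
  let φ : S →ₐ[R] Ω₂ := (MvPolynomial.aeval fun i => (g i : Ω₂)).comp
    (hs.1.aevalEquiv.symm : S →ₐ[R] MvPolynomial s R)
  have hφ : Function.Injective φ :=
    (show Function.Injective (MvPolynomial.aeval fun i => (g i : Ω₂)) from hy).comp
      hs.1.aevalEquiv.symm.injective
  let := φ.toRingHom.toAlgebra
  have : FaithfulSMul S Ω₂ := (faithfulSMul_iff_algebraMap_injective S Ω₂).2 hφ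
  have : IsScalarTower R S Ω₂ := .of_algebraMap_eq fun r => (φ.commutes r).symm
  have : Algebra.IsAlgebraic S Ω₁ := hs.isAlgebraic
  exact ⟨(IsAlgClosed.lift : Ω₁ →ₐ[S] Ω₂).restrictScalars R⟩

/-- Two embeddings `j`, `s` of `R` in algebraically closed fields that are conjugate over a
subring of `R` over which the transcendence degree is finite are conjugate. -/
theorem exists_ringHom_comp_eq {K : Type u} {R Ω₁ Ω₂ : Type z} [CommRing K] [IsDomain K]
    [CommRing R] [IsDomain R] [Field Ω₁] [Field Ω₂] [IsAlgClosed Ω₂] [Algebra K R]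
    [FaithfulSMul K R] [Algebra K Ω₁] (hfin : Algebra.trdeg K Ω₁ < Cardinal.aleph0)
    (j : R →+* Ω₁) (hj : Function.Injective j)
    (hjK : ∀ k, j (algebraMap K R k) = algebraMap K Ω₁ k)
    (s : R →+* Ω₂) (hs : Function.Injective s) (σ : K ≃+* K) (ρ : Ω₁ →+* Ω₂)
    (h : ∀ k, s (algebraMap K R k) = ρ (algebraMap K Ω₁ (σ k))) :
    ∃ τ : Ω₁ →+* Ω₂, τ.comp j = s := by
  let := j.toAlgebra
  let := s.toAlgebra
  let := (s.comp (algebraMap K R)).toAlgebra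
  have : IsScalarTower K R Ω₁ := .of_algebraMap_eq fun k => (hjK k).symm
  have : IsScalarTower K R Ω₂ := .of_algebraMap_eq fun _ => rfl
  have : FaithfulSMul R Ω₁ := (faithfulSMul_iff_algebraMap_injective R Ω₁).2 hj
  have : FaithfulSMul R Ω₂ := (faithfulSMul_iff_algebraMap_injective R Ω₂).2 hs
  have : FaithfulSMul K Ω₁ := .trans K R Ω₁
  -- `K` acts on `Ω₂` through `ρ ∘ σ`. As `σ` is bijective, `ρ` carries algebraically independent
  -- families over `K` to such families.
  have hle : Algebra.trdeg K Ω₁ ≤ Algebra.trdeg K Ω₂ := by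
    obtain ⟨x, hx⟩ := exists_isTranscendenceBasis K Ω₁
    rw [← hx.cardinalMk_eq_trdeg]
    exact (hx.1.ringHom_of_comp_eq σ.symm ρ σ.symm.surjective ρ.injective
      (RingHom.ext fun k => (h _).trans (by simp))).cardinalMk_le_trdeg
  rw [← trdeg_add_eq K R (A := Ω₁)] at hfin
  rw [← trdeg_add_eq K R (A := Ω₁), ← trdeg_add_eq K R (A := Ω₂), add_comm,
    add_comm (Algebra.trdeg K R)] at hle
  -- The common summand `trdeg K R` is finite, so it cancels.
  obtain ⟨τ⟩ := exists_algHom_of_trdeg_le (R := R) (Ω₁ := Ω₁) (Ω₂ := Ω₂)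
    ((Cardinal.add_le_add_iff_of_lt_aleph0 (lt_of_le_of_lt (self_le_add_right _ _) hfin)).1 hle)
  exact ⟨τ, τ.comp_algebraMap⟩

theorem exists_ringHom_comp_eq_of_isAlgebraic {R Ω₁ Ω₂ : Type*} [CommRing R] [IsDomain R]
    [Field Ω₁] [Field Ω₂] [IsAlgClosed Ω₂] [Algebra R Ω₁] [FaithfulSMul R Ω₁]
    [Algebra.IsAlgebraic R Ω₁] (s : R →+* Ω₂) (hs : Function.Injective s) :
    ∃ τ : Ω₁ →+* Ω₂, τ.comp (algebraMap R Ω₁) = s := by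
  let := s.toAlgebra
  have : FaithfulSMul R Ω₂ := (faithfulSMul_iff_algebraMap_injective R Ω₂).2 hs
  exact ⟨(IsAlgClosed.lift : Ω₁ →ₐ[R] Ω₂), AlgHom.comp_algebraMap _⟩

/-! ### Coordinates of `𝒟(R)` and embeddings of `𝒟`-rings -/

namespace OperatorData

section

variable {A : Type u} [CommRing A] (𝒟 : OperatorData.{u, v} A)

/-- The map `𝒟(f) : 𝒟(R) → 𝒟(R')` induced by `f : R → R'`. -/
noncomputable def baseMap {R : Type*} {R' : Type*} [CommRing R] [Algebra A R] [CommRing R']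
    [Algebra A R'] (f : R →ₐ[A] R') : R ⊗[A] 𝒟.alg →ₐ[A] R' ⊗[A] 𝒟.alg :=
  Algebra.TensorProduct.map f (AlgHom.id A 𝒟.alg)

@[simp]
theorem baseMap_tmul {R R' : Type*} [CommRing R] [Algebra A R] [CommRing R']
    [Algebra A R'] (f : R →ₐ[A] R') (r : R) (d : 𝒟.alg) :
    𝒟.baseMap f (r ⊗ₜ d) = f r ⊗ₜ d := by
  simp [baseMap]

/-- The coefficient of `ε j` of an element of `𝒟(R)`. -/
noncomputable def coeff (R : Type*) [CommRing R] [Algebra A R] (j : Fin (𝒟.m + 1)) :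
    R ⊗[A] 𝒟.alg →ₗ[R] R :=
  (𝒟.ε.baseChange R).coord j

variable {R : Type*} [CommRing R] [Algebra A R]

theorem coeff_tmul_basis (j k : Fin (𝒟.m + 1)) (r : R) :
    𝒟.coeff R j (r ⊗ₜ 𝒟.ε k) = if k = j then r else 0 := by
  simp [coeff, Finsupp.single_apply]

theorem sum_coeff_tmul (x : R ⊗[A] 𝒟.alg) : ∑ j, 𝒟.coeff R j x ⊗ₜ[A] 𝒟.ε j = x := by
  conv_rhs => rw [← (𝒟.ε.baseChange R).sum_repr x]
  simp [coeff, TensorProduct.smul_tmul']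

theorem coeff_sum (r : Fin (𝒟.m + 1) → R) (k : Fin (𝒟.m + 1)) :
    𝒟.coeff R k (∑ j, r j ⊗ₜ[A] 𝒟.ε j) = r k := by
  simp [coeff_tmul_basis]

theorem ext_coeff {x y : R ⊗[A] 𝒟.alg} (h : ∀ j, 𝒟.coeff R j x = 𝒟.coeff R j y) : x = y := by
  rw [← 𝒟.sum_coeff_tmul x, ← 𝒟.sum_coeff_tmul y]
  simp [h]

theorem coeff_baseMap {R' : Type*} [CommRing R'] [Algebra A R'] (f : R →ₐ[A] R')
    (j : Fin (𝒟.m + 1)) (x : R ⊗[A] 𝒟.alg) :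
    𝒟.coeff R' j (𝒟.baseMap f x) = f (𝒟.coeff R j x) := by
  conv_lhs => rw [← 𝒟.sum_coeff_tmul x, map_sum]
  simp only [baseMap_tmul]
  rw [coeff_sum]

theorem dring_e_eq_sum [DRing 𝒟 R] (r : R) :
    DRing.e (𝒟 := 𝒟) r = ∑ j, Fin.cons (α := fun _ => R) r (fun i => DRing.op (𝒟 := 𝒟) i r) j
      ⊗ₜ[A] 𝒟.ε j := by
  rw [DRing.e_apply, Fin.sum_univ_succ]
  simp

theorem coeff_zero_e [DRing 𝒟 R] (r : R) : 𝒟.coeff R 0 (DRing.e (𝒟 := 𝒟) r) = r := by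
  rw [dring_e_eq_sum, coeff_sum, Fin.cons_zero]

theorem coeff_succ_e [DRing 𝒟 R] (r : R) (i : Fin 𝒟.m) :
    𝒟.coeff R i.succ (DRing.e (𝒟 := 𝒟) r) = DRing.op (𝒟 := 𝒟) i r := by
  rw [dring_e_eq_sum, coeff_sum, Fin.cons_succ]

theorem nabla_apply [DRing 𝒟 R] {n : ℕ} (a : Fin n → R) (p : Fin n × Fin (𝒟.m + 1)) :
    𝒟.nabla a p = 𝒟.coeff R p.2 (DRing.e (𝒟 := 𝒟) (a p.1)) := by
  rw [dring_e_eq_sum, coeff_sum, nabla]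

theorem e_eq_sum_nabla [DRing 𝒟 R] {n : ℕ} (a : Fin n → R) (k : Fin n) :
    DRing.e (𝒟 := 𝒟) (a k) = ∑ j, 𝒟.nabla a (k, j) ⊗ₜ[A] 𝒟.ε j := by
  simp only [nabla_apply, sum_coeff_tmul]

theorem e_injective [DRing 𝒟 R] : Function.Injective (DRing.e (𝒟 := 𝒟) (R := R)) := fun r s h => by
  rw [← 𝒟.coeff_zero_e r, h, coeff_zero_e]

/-- A section of `𝒟(R) → R` defines a `𝒟`-ring structure on `R`. -/
@[reducible]
noncomputable def dringOfHom (E : R →ₐ[A] R ⊗[A] 𝒟.alg) (hE : ∀ r, 𝒟.coeff R 0 (E r) = r) :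
    DRing 𝒟 R where
  op i r := 𝒟.coeff R i.succ (E r)
  e := E
  e_apply r := by
    conv_lhs => rw [← 𝒟.sum_coeff_tmul (E r), Fin.sum_univ_succ, hE]

section Embedding

variable {K L : Type*} [CommRing K] [Algebra A K] [DRing 𝒟 K] [CommRing L] [Algebra A L]
  [DRing 𝒟 L]

/-- An injective homomorphism that commutes with `e` is an embedding of structures. -/
def embeddingOfAlgHom (f : K →ₐ[A] L) (hf : Function.Injective f)
    (h : ∀ r, DRing.e (𝒟 := 𝒟) (f r) = 𝒟.baseMap f (DRing.e (𝒟 := 𝒟) r)) :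
    𝒟.lang.Embedding K L where
  toFun := f
  inj' := hf
  map_fun' g x := by
    cases g with
    | zero => exact map_zero f
    | one => exact map_one f
    | add => exact map_add f _ _
    | neg => exact map_neg f _
    | mul => exact map_mul f _ _
    | smul a => exact map_smul f a _
    | op i =>
      change f (DRing.op (𝒟 := 𝒟) i (x 0)) = DRing.op (𝒟 := 𝒟) i (f (x 0))
      rw [← coeff_succ_e, ← coeff_succ_e, h, coeff_baseMap]
  map_rel' r := nomatch r

/-- The homomorphism of `A`-algebras that underlies an embedding of structures. -/
def algHomOfEmbedding (f : 𝒟.lang.Embedding K L) : K →ₐ[A] L where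
  toFun := f
  map_one' := (f.map_fun (Func.one : 𝒟.lang.Functions 0) ![]).trans rfl
  map_zero' := (f.map_fun (Func.zero : 𝒟.lang.Functions 0) ![]).trans rfl
  map_mul' x y := (f.map_fun (Func.mul : 𝒟.lang.Functions 2) ![x, y]).trans rfl
  map_add' x y := (f.map_fun (Func.add : 𝒟.lang.Functions 2) ![x, y]).trans rfl
  commutes' a := by
    have h1 : f (a • (1 : K)) = a • f 1 := f.map_fun (Func.smul a : 𝒟.lang.Functions 1) ![1]
    have h2 : f (1 : K) = 1 := (f.map_fun (Func.one : 𝒟.lang.Functions 0) ![]).trans rfl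
    rw [h2, ← Algebra.algebraMap_eq_smul_one, ← Algebra.algebraMap_eq_smul_one] at h1
    exact h1

theorem algHomOfEmbedding_op (f : 𝒟.lang.Embedding K L) (i : Fin 𝒟.m) (x : K) :
    DRing.op (𝒟 := 𝒟) i (𝒟.algHomOfEmbedding f x) =
      𝒟.algHomOfEmbedding f (DRing.op (𝒟 := 𝒟) i x) :=
  (f.map_fun (Func.op i : 𝒟.lang.Functions 1) ![x]).symm

theorem e_algHomOfEmbedding (f : 𝒟.lang.Embedding K L) (x : K) :
    DRing.e (𝒟 := 𝒟) (𝒟.algHomOfEmbedding f x) =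
      𝒟.baseMap (𝒟.algHomOfEmbedding f) (DRing.e (𝒟 := 𝒟) x) := by
  simp [DRing.e_apply, algHomOfEmbedding_op]

end Embedding

end

end OperatorData

/-! ### The maps `π_i` and extension of `𝒟`-structures -/

namespace LocalSplitting

variable {A : Type u} [Field A] {𝒟 : OperatorData.{u, v} A} (S : LocalSplitting.{u, v, w} 𝒟)

theorem algebraMap_pi (i : Fin (S.t + 1)) (d : 𝒟.alg) :
    algebraMap A (IsLocalRing.ResidueField (S.B i)) (S.pi i d) =
      IsLocalRing.residue (S.B i) (S.split d i) := by
  exact (AlgEquiv.ofBijective (Algebra.ofId A (IsLocalRing.ResidueField (S.B i)))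
      (S.residue_bijective i)).apply_symm_apply _

theorem pi_zero : S.pi 0 = 𝒟.π := by
  ext d
  exact (S.residue_bijective 0).1 ((S.algebraMap_pi 0 d).trans (S.residue_zero d))

theorem pi_eq_zero_iff (i : Fin (S.t + 1)) (d : 𝒟.alg) :
    S.pi i d = 0 ↔ ¬ IsUnit (S.split d i) := by
  rw [← (S.residue_bijective i).1.eq_iff, map_zero, algebraMap_pi,
    IsLocalRing.residue_eq_zero_iff, IsLocalRing.mem_maximalIdeal, mem_nonunits_iff]

/-- All the homomorphisms `π_i` together. -/
noncomputable def piAll : 𝒟.alg →ₐ[A] (Fin (S.t + 1) → A) :=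
  AlgHom.pi S.pi

theorem piAll_surjective : Function.Surjective S.piAll := fun x => by
  refine ⟨S.split.symm fun i => algebraMap A (S.B i) (x i), ?_⟩
  ext i
  apply (S.residue_bijective i).1
  change algebraMap A (IsLocalRing.ResidueField (S.B i)) (S.pi i _) = _
  rw [algebraMap_pi, AlgEquiv.apply_symm_apply]
  rfl

/-- If all `π_i` kill `d`, then `d * y + 1` is a unit in each local factor, so `d` is in the
Jacobson radical, which is nilpotent since `𝒟.alg` is Artinian. -/
theorem isNilpotent_ker_piAll : IsNilpotent (RingHom.ker S.piAll) := by
  have : Module.Finite A 𝒟.alg := .of_basis 𝒟.ε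
  have : IsArtinianRing 𝒟.alg := .of_finite A 𝒟.alg
  obtain ⟨n, hn⟩ := IsArtinianRing.isNilpotent_jacobson_bot (R := 𝒟.alg)
  refine ⟨n, le_bot_iff.1 ((Ideal.pow_right_mono (fun d hd => ?_) n).trans hn.le)⟩
  rw [Ideal.mem_jacobson_bot]
  intro y
  have key : IsUnit (S.split (d * y + 1)) := by
    rw [Pi.isUnit_iff]
    intro i
    rw [← not_not (a := IsUnit _), ← pi_eq_zero_iff]
    have hd : S.pi i d = 0 := congrFun (RingHom.mem_ker.1 hd) i
    simp [hd]
  exact (MulEquiv.isUnit_map S.split).1 key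

section

variable (R : Type*) [CommRing R] [Algebra A R]

theorem piBase_tmul (i : Fin (S.t + 1)) (r : R) (d : 𝒟.alg) :
    S.piBase R i (r ⊗ₜ d) = S.pi i d • r := by
  simp [piBase]

theorem piBase_eq_sum (i : Fin (S.t + 1)) (x : R ⊗[A] 𝒟.alg) :
    S.piBase R i x = ∑ j, S.pi i (𝒟.ε j) • 𝒟.coeff R j x := by
  conv_lhs => rw [← 𝒟.sum_coeff_tmul x, map_sum]
  simp only [piBase_tmul]

theorem piBase_zero (x : R ⊗[A] 𝒟.alg) : S.piBase R 0 x = 𝒟.coeff R 0 x := by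
  rw [piBase_eq_sum, Fin.sum_univ_succ, pi_zero, 𝒟.π_zero]
  simp [𝒟.π_succ]

/-- All the homomorphisms `π_i : 𝒟(R) → R` together. -/
noncomputable def piBaseAll : R ⊗[A] 𝒟.alg →ₐ[R] (Fin (S.t + 1) → R) :=
  AlgHom.pi (S.piBase R)

/-- Being a base change of `piAll`, the map inherits surjectivity and nilpotence of the kernel by
right exactness of the tensor product. -/
theorem piBaseAll_eq : S.piBaseAll R =
    (Algebra.TensorProduct.piScalarRight A R R (Fin (S.t + 1))).toAlgHom.comp
      (Algebra.TensorProduct.map (AlgHom.id R R) S.piAll) := by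
  ext x i
  simp [piBaseAll, piAll, piBase_tmul]

theorem piBaseAll_surjective : Function.Surjective (S.piBaseAll R) := by
  rw [piBaseAll_eq]
  exact (Algebra.TensorProduct.piScalarRight A R R (Fin (S.t + 1))).surjective.comp
    (LinearMap.lTensor_surjective R (g := S.piAll.toLinearMap) S.piAll_surjective)

theorem isNilpotent_ker_piBaseAll : IsNilpotent (RingHom.ker (S.piBaseAll R)) := by
  have h : RingHom.ker (S.piBaseAll R) =
      RingHom.ker (Algebra.TensorProduct.map (AlgHom.id R R) S.piAll) := by
    ext x
    simp [piBaseAll_eq, RingHom.mem_ker]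
  have h' := Algebra.TensorProduct.lTensor_ker (R := A) (A := R) S.piAll S.piAll_surjective
  obtain ⟨n, hn⟩ := S.isNilpotent_ker_piAll
  refine ⟨n, ?_⟩
  rw [h]
  erw [h']
  rw [← Ideal.map_pow, hn]
  exact Ideal.map_bot

variable {R}

theorem piBase_baseMap {R' : Type*} [CommRing R'] [Algebra A R'] (f : R →ₐ[A] R')
    (i : Fin (S.t + 1)) (x : R ⊗[A] 𝒟.alg) :
    S.piBase R' i (𝒟.baseMap f x) = f (S.piBase R i x) := by
  simp [piBase_eq_sum, OperatorData.coeff_baseMap]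

theorem exists_piBase_eq (r : Fin (S.t + 1) → R) :
    ∃ x : R ⊗[A] 𝒟.alg, ∀ i, S.piBase R i x = r i := by
  obtain ⟨x, hx⟩ := S.piBaseAll_surjective R r
  exact ⟨x, fun i => congrFun hx i⟩

theorem σ_apply [DRing 𝒟 R] (i : Fin (S.t + 1)) (r : R) :
    S.σ R i r = S.piBase R i (DRing.e (𝒟 := 𝒟) r) := rfl

theorem σ_zero [DRing 𝒟 R] (r : R) : S.σ R 0 r = r := by
  rw [σ_apply, piBase_zero, OperatorData.coeff_zero_e]

theorem σ_eq_sum [DRing 𝒟 R] (i : Fin (S.t + 1)) {n : ℕ} (a : Fin n → R) (k : Fin n) :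
    S.σ R i (a k) = ∑ j, S.pi i (𝒟.ε j) • 𝒟.nabla a (k, j) := by
  simp [σ_apply, piBase_eq_sum, OperatorData.nabla_apply]

variable {S} in
theorem InClass.σ_injective [DRing 𝒟 R] (h : S.InClass R) (i : Fin (S.t + 1)) :
    Function.Injective (S.σ R i) := by
  cases i using Fin.cases with
  | zero => exact fun x y hxy => by simpa [σ_zero] using hxy
  | succ i => exact h.injective i

variable {S} in
theorem IsInversive.σ_surjective [DRing 𝒟 R] (h : S.IsInversive R) (i : Fin (S.t + 1)) :
    Function.Surjective (S.σ R i) := by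
  cases i using Fin.cases with
  | zero => exact fun x => ⟨x, S.σ_zero x⟩
  | succ i => exact h i

end

/-- A homomorphism `e : R → 𝒟(Ω)` over an inclusion of `R` in a field `Ω` extends to a
`𝒟`-ring structure on `Ω` if its associated homomorphisms `R → Ω` extend to `Ω`. -/
theorem exists_dring_extending {R Ω : Type*} [CommRing R] [IsDomain R] [CharZero R] [Algebra A R]
    [Field Ω] [Algebra A Ω] (j : R →ₐ[A] Ω) (hj : Function.Injective j)
    (e : R →ₐ[A] Ω ⊗[A] 𝒟.alg) (h0 : ∀ r, S.piBase Ω 0 (e r) = j r)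
    (hτ : ∀ i : Fin S.t, ∃ τ : Ω →+* Ω, ∀ r, τ (j r) = S.piBase Ω i.succ (e r)) :
    ∃ d : DRing 𝒟 Ω, S.InClass Ω ∧ ∀ r, d.e (j r) = e r := by
  -- At index `0` the identity must be chosen: this makes the lift `E` a section of `𝒟(Ω) → Ω`.
  have hτ' : ∀ i : Fin (S.t + 1), ∃ τ : Ω →+* Ω, (∀ r, τ (j r) = S.piBase Ω i (e r)) ∧
      (i = 0 → τ = RingHom.id Ω) := fun i => by
    cases i using Fin.cases with
    | zero => exact ⟨RingHom.id Ω, fun r => (h0 r).symm, fun _ => rfl⟩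
    | succ i =>
      obtain ⟨τ, h⟩ := hτ i
      exact ⟨τ, h, fun h => absurd h (Fin.succ_ne_zero i)⟩
  choose τ hτ hτ0 using hτ'
  obtain ⟨E, hE, hE'⟩ := (RingHom.formallySmooth_of_charZero (j : R →+* Ω) hj).exists_lift
    (e : R →+* Ω ⊗[A] 𝒟.alg) (S.piBaseAll Ω : Ω ⊗[A] 𝒟.alg →+* (Fin (S.t + 1) → Ω))
    (S.piBaseAll_surjective Ω) (S.isNilpotent_ker_piBaseAll Ω) (RingHom.pi τ) <| by
      ext r i
      exact (hτ i r).symm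
  have hEj : ∀ r, E (j r) = e r := RingHom.congr_fun hE
  have hEπ : ∀ i x, S.piBase Ω i (E x) = τ i x := fun i x => congrFun (RingHom.congr_fun hE' x) i
  let E' : Ω →ₐ[A] Ω ⊗[A] 𝒟.alg :=
    { E with
      commutes' := fun a => by
        change E (algebraMap A Ω a) = _
        rw [← j.commutes, hEj, e.commutes] }
  let d : DRing 𝒟 Ω := 𝒟.dringOfHom E' fun r => by
    rw [← S.piBase_zero]
    exact (hEπ 0 r).trans (by rw [hτ0 0 rfl]; rfl)
  refine ⟨d, ⟨inferInstance, charZero_of_injective_ringHom (f := (j : R →+* Ω)) hj, fun i => ?_⟩,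
    hEj⟩
  have : ⇑(S.σ Ω i.succ) = τ i.succ := funext (hEπ i.succ)
  rw [this]
  exact (τ i.succ).injective

/-- A member of `𝒦` extends to a member of `𝒦` on each algebraically closed field that is
algebraic over it. -/
theorem InClass.exists_extension_of_isAlgebraic {S : LocalSplitting.{u, v, w} 𝒟} {R Ω : Type*}
    [CommRing R] [Algebra A R] [DRing 𝒟 R] (hR : S.InClass R) [Field Ω] [Algebra A Ω]
    [Algebra R Ω] [IsScalarTower A R Ω] [FaithfulSMul R Ω] [Algebra.IsAlgebraic R Ω]
    [IsAlgClosed Ω] :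
    ∃ _ : DRing 𝒟 Ω, S.InClass Ω ∧ ∃ f : 𝒟.lang.Embedding R Ω, ∀ r, f r = algebraMap R Ω r := by
  have := hR.isDomain
  have := hR.charZero
  let j : R →ₐ[A] Ω := IsScalarTower.toAlgHom A R Ω
  have hj : Function.Injective j := FaithfulSMul.algebraMap_injective R Ω
  let e := (𝒟.baseMap j).comp (DRing.e (𝒟 := 𝒟) (R := R))
  have he : ∀ i r, S.piBase Ω i (e r) = j (S.σ R i r) := fun i r => S.piBase_baseMap j i _
  obtain ⟨_, hd, h⟩ := S.exists_dring_extending j hj e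
    (fun r => by rw [he, σ_zero]) fun i => by
      obtain ⟨τ, hτ⟩ := exists_ringHom_comp_eq_of_isAlgebraic (Ω₁ := Ω)
        ((j : R →+* Ω).comp (S.σ R i.succ : R →+* R)) (hj.comp (hR.injective i))
      exact ⟨τ, fun r => (RingHom.congr_fun hτ r).trans (he _ _).symm⟩
  exact ⟨_, hd, 𝒟.embeddingOfAlgHom j hj h, fun _ => rfl⟩

end LocalSplitting

/-! ### Formulas and specializations -/

namespace OperatorData

variable {A : Type u} [CommRing A] (𝒟 : OperatorData.{u, v} A)

section Terms

/-- The symbol for zero. -/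
def zeroSymb : 𝒟.lang.Functions 0 := Func.zero

/-- The symbol for addition. -/
def addSymb : 𝒟.lang.Functions 2 := Func.add

/-- The symbol for multiplication. -/
def mulSymb : 𝒟.lang.Functions 2 := Func.mul

/-- The symbol for an operator. -/
def opSymb (i : Fin 𝒟.m) : 𝒟.lang.Functions 1 := Func.op i

variable {K : Type z} [CommRing K] [Algebra A K]

/-- Polynomials in the coordinates of `∇ x` are given by terms with parameters. -/
theorem exists_term_realize_eq {n : ℕ} (P : MvPolynomial (Fin n × Fin (𝒟.m + 1)) K) :
    ∃ (r : ℕ) (c : Fin r → K) (t : 𝒟.lang.Term (Fin r ⊕ Fin n)),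
      ∀ (M : Type z) [CommRing M] [Algebra A M] [DRing 𝒟 M] (g : K →ₐ[A] M) (x : Fin n → M),
        t.realize (Sum.elim (g ∘ c) x) = aevalTower g (𝒟.nabla x) P := by
  induction P using MvPolynomial.induction_on with
  | C a =>
    refine ⟨1, ![a], .var (.inl 0), fun M _ _ _ g x => ?_⟩
    simp
  | add p q hp hq =>
    obtain ⟨r, c, t, ht⟩ := hp
    obtain ⟨r', c', t', ht'⟩ := hq
    refine ⟨r + r', Fin.append c c', Functions.apply₂ 𝒟.addSymb
      (t.relabel (Sum.map (Fin.castAdd r') id)) (t'.relabel (Sum.map (Fin.natAdd r) id)),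
      fun M _ _ _ g x => ?_⟩
    rw [map_add, ← ht, ← ht', Term.realize_functions_apply₂, Term.realize_relabel,
      Term.realize_relabel]
    have h1 : Sum.elim (g ∘ Fin.append c c') x ∘ Sum.map (Fin.castAdd r') id =
        Sum.elim (g ∘ c) x := by
      ext (i | i) <;> simp
    have h2 : Sum.elim (g ∘ Fin.append c c') x ∘ Sum.map (Fin.natAdd r) id =
        Sum.elim (g ∘ c') x := by
      ext (i | i) <;> simp
    rw [h1, h2]
    rfl
  | mul_X p k hp =>
    obtain ⟨r, c, t, ht⟩ := hp
    obtain ⟨k, j⟩ := k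
    have key : ∃ t' : 𝒟.lang.Term (Fin r ⊕ Fin n), ∀ (M : Type z) [CommRing M] [Algebra A M]
        [DRing 𝒟 M] (v : Fin r → M) (x : Fin n → M),
        t'.realize (Sum.elim v x) = 𝒟.nabla x (k, j) := by
      cases j using Fin.cases with
      | zero => exact ⟨.var (.inr k), fun M _ _ _ v x => rfl⟩
      | succ j =>
        refine ⟨Functions.apply₁ (𝒟.opSymb j) (.var (.inr k)),
          fun M _ _ _ v x => ?_⟩
        rw [Term.realize_functions_apply₁]
        rfl
    obtain ⟨t', ht'⟩ := key
    refine ⟨r, c, Functions.apply₂ 𝒟.mulSymb t t', fun M _ _ _ g x => ?_⟩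
    rw [map_mul, ← ht, aevalTower_X, ← ht' M (g ∘ c), Term.realize_functions_apply₂]
    rfl

/-- Finite systems of equations in the coordinates of `∇ x` are given by quantifier-free formulas
with parameters. -/
theorem exists_formula_realize_iff {n : ℕ} (s : Finset (MvPolynomial (Fin n × Fin (𝒟.m + 1)) K)) :
    ∃ (r : ℕ) (c : Fin r → K) (φ : 𝒟.lang.Formula (Fin r ⊕ Fin n)), φ.IsQF ∧
      ∀ (M : Type z) [CommRing M] [Algebra A M] [DRing 𝒟 M] (g : K →ₐ[A] M) (x : Fin n → M),
        φ.Realize (Sum.elim (g ∘ c) x) ↔ ∀ P ∈ s, aevalTower g (𝒟.nabla x) P = 0 := by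
  classical
  induction s using Finset.induction_on with
  | empty => exact ⟨0, Fin.elim0, ⊤, .top, fun M _ _ _ g x => by simp⟩
  | insert P s _ hs =>
    obtain ⟨r, c, φ, hφ, h⟩ := hs
    obtain ⟨r', c', t, ht⟩ := 𝒟.exists_term_realize_eq P
    refine ⟨r + r', Fin.append c c', φ.relabel (Sum.map (Fin.castAdd r') id) ⊓
      (t.relabel (Sum.map (Fin.natAdd r) id)).equal
        (Functions.term 𝒟.zeroSymb |>.relabel Fin.elim0),
      (BoundedFormula.IsQF.relabel hφ _).inf (BoundedFormula.IsAtomic.equal _ _).isQF,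
      fun M _ _ _ g x => ?_⟩
    have h1 : Sum.elim (g ∘ Fin.append c c') x ∘ Sum.map (Fin.castAdd r') id =
        Sum.elim (g ∘ c) x := by
      ext (i | i) <;> simp
    have h2 : Sum.elim (g ∘ Fin.append c c') x ∘ Sum.map (Fin.natAdd r) id =
        Sum.elim (g ∘ c') x := by
      ext (i | i) <;> simp
    rw [Formula.realize_inf, Formula.realize_relabel, h1, h, Formula.realize_equal,
      Term.realize_relabel, h2, ht, Finset.forall_mem_insert, and_comm]
    rfl

end Terms

section Specialization

variable {K L : Type*} [CommRing K] [Algebra A K] [DRing 𝒟 K] [CommRing L] [Algebra A L]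
  [DRing 𝒟 L]

/-- A map `s : L → K` that respects, on the set `T`, the operations of `𝒟`-rings
and the elements of `K`. -/
structure IsSpecialization (j : K →ₐ[A] L) (T : Set L) (s : L → K) : Prop where
  const : ∀ c, j c ∈ T → s (j c) = c
  add : ∀ x ∈ T, ∀ y ∈ T, x + y ∈ T → s (x + y) = s x + s y
  mul : ∀ x ∈ T, ∀ y ∈ T, x * y ∈ T → s (x * y) = s x * s y
  neg : ∀ x ∈ T, -x ∈ T → s (-x) = -s x
  smul : ∀ (a : A), ∀ x ∈ T, a • x ∈ T → s (a • x) = a • s x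
  op : ∀ i, ∀ x ∈ T, DRing.op (𝒟 := 𝒟) i x ∈ T →
    s (DRing.op (𝒟 := 𝒟) i x) = DRing.op (𝒟 := 𝒟) i (s x)

variable {𝒟}

theorem IsSpecialization.mono {j : K →ₐ[A] L} {T T' : Set L} {s : L → K}
    (h : 𝒟.IsSpecialization j T s) (hT : T' ⊆ T) : 𝒟.IsSpecialization j T' s where
  const c hc := h.const c (hT hc)
  add x hx y hy hxy := h.add x (hT hx) y (hT hy) (hT hxy)
  mul x hx y hy hxy := h.mul x (hT hx) y (hT hy) (hT hxy)
  neg x hx hx' := h.neg x (hT hx) (hT hx')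
  smul a x hx hx' := h.smul a x (hT hx) (hT hx')
  op i x hx hx' := h.op i x (hT hx) (hT hx')

theorem IsSpecialization.zero {j : K →ₐ[A] L} {T : Set L} {s : L → K}
    (h : 𝒟.IsSpecialization j T s) (h0 : 0 ∈ T) : s 0 = 0 := by
  simpa using h.const 0 (by simpa using h0)

theorem IsSpecialization.one {j : K →ₐ[A] L} {T : Set L} {s : L → K}
    (h : 𝒟.IsSpecialization j T s) (h1 : 1 ∈ T) : s 1 = 1 := by
  simpa using h.const 1 (by simpa using h1)

/-- `T` consists of the values of all subterms, so every operation performed in evaluating `t` stays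
inside `T`. -/
theorem exists_finset_specialization_term (j : K →ₐ[A] L) {α : Type*} (t : 𝒟.lang.Term α)
    (v : α → L) : ∃ T : Finset L, t.realize v ∈ T ∧
      ∀ s, 𝒟.IsSpecialization j T s → s (t.realize v) = t.realize (s ∘ v) := by
  classical
  induction t with
  | var a => exact ⟨{v a}, by simp, fun s _ => rfl⟩
  | @func l f ts ih =>
    choose T hT hs using ih
    refine ⟨insert ((Term.func f ts).realize v) (Finset.univ.biUnion T), by simp, fun s h => ?_⟩
    have hTs : ∀ i, s ((ts i).realize v) = (ts i).realize (s ∘ v) := fun i =>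
      hs i s (h.mono fun x hx => by
        simp only [Finset.coe_insert, Set.mem_insert_iff, Finset.mem_coe, Finset.mem_biUnion]
        exact Or.inr ⟨i, Finset.mem_univ i, hx⟩)
    have hmem : ∀ i, (ts i).realize v ∈
        (↑(insert ((Term.func f ts).realize v) (Finset.univ.biUnion T)) : Set L) := fun i => by
      simp only [Finset.coe_insert, Set.mem_insert_iff, Finset.mem_coe, Finset.mem_biUnion]
      exact Or.inr ⟨i, Finset.mem_univ i, hT i⟩
    have hmem' : (Term.func f ts).realize v ∈
        (↑(insert ((Term.func f ts).realize v) (Finset.univ.biUnion T)) : Set L) := by simp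
    simp only [Term.realize_func, ← hTs]
    cases f with
    | zero => exact h.zero hmem'
    | one => exact h.one hmem'
    | add => exact h.add _ (hmem 0) _ (hmem 1) hmem'
    | neg => exact h.neg _ (hmem 0) hmem'
    | mul => exact h.mul _ (hmem 0) _ (hmem 1) hmem'
    | smul a => exact h.smul a _ (hmem 0) hmem'
    | op i => exact h.op i _ (hmem 0) hmem'

/-- A specialization on a sufficiently large finite subset of a field preserves the truth of a
given quantifier-free formula. -/
theorem exists_finset_specialization_formula {L : Type*} [Field L] [Algebra A L] [DRing 𝒟 L]
    [Nontrivial K] (j : K →ₐ[A] L) {α : Type*} {n : ℕ} {φ : 𝒟.lang.BoundedFormula α n}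
    (hφ : φ.IsQF) (v : α → L) (xs : Fin n → L) :
    ∃ T : Finset L, ∀ s, 𝒟.IsSpecialization j T s →
      (φ.Realize v xs ↔ φ.Realize (s ∘ v) (s ∘ xs)) := by
  classical
  induction hφ with
  | falsum => exact ⟨∅, fun s _ => Iff.rfl⟩
  | of_isAtomic h =>
    cases h with
    | equal t₁ t₂ =>
      obtain ⟨T₁, hT₁, h₁⟩ := exists_finset_specialization_term j t₁ (Sum.elim v xs)
      obtain ⟨T₂, hT₂, h₂⟩ := exists_finset_specialization_term j t₂ (Sum.elim v xs)
      set a := t₁.realize (Sum.elim v xs)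
      set b := t₂.realize (Sum.elim v xs)
      -- With the inverse in the set, `a ≠ b` forces `s a ≠ s b`: otherwise `(a + -b) * (a + -b)⁻¹ =
      -- 1` would specialize to `0 = 1`.
      refine ⟨{-b, a + -b, (a + -b)⁻¹, 1} ∪ T₁ ∪ T₂, fun s h => ?_⟩
      have hT : ∀ x ∈ T₁, x ∈ (↑({-b, a + -b, (a + -b)⁻¹, 1} ∪ T₁ ∪ T₂ : Finset L) : Set L) :=
        fun x hx => by simp [hx]
      have hT' : ∀ x ∈ T₂, x ∈ (↑({-b, a + -b, (a + -b)⁻¹, 1} ∪ T₁ ∪ T₂ : Finset L) : Set L) :=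
        fun x hx => by simp [hx]
      rw [BoundedFormula.realize_bdEqual, BoundedFormula.realize_bdEqual, ← Sum.comp_elim,
        ← h₁ s (h.mono hT), ← h₂ s (h.mono hT')]
      refine ⟨fun hab => congrArg s hab, fun hab => ?_⟩
      by_contra hne
      have hne' : a + -b ≠ 0 := by rwa [← sub_eq_add_neg, sub_ne_zero]
      have e1 : s (-b) = -s b := h.neg b (hT' b hT₂) (by simp)
      have e2 : s (a + -b) = s a + s (-b) := h.add a (hT a hT₁) (-b) (by simp) (by simp)
      have e3 := h.mul (a + -b) (by simp) (a + -b)⁻¹ (by simp) (by simp [mul_inv_cancel₀ hne'])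
      rw [mul_inv_cancel₀ hne', h.one (by simp), e2, e1, hab, add_neg_cancel, zero_mul] at e3
      exact one_ne_zero e3
    | rel R ts => exact nomatch R
  | imp _ _ ih₁ ih₂ =>
    obtain ⟨T₁, h₁⟩ := ih₁
    obtain ⟨T₂, h₂⟩ := ih₂
    refine ⟨T₁ ∪ T₂, fun s h => ?_⟩
    rw [BoundedFormula.realize_imp, BoundedFormula.realize_imp, h₁ s (h.mono (by simp)),
      h₂ s (h.mono (by simp))]

end Specialization

end OperatorData

/-! ### Points of prolongations -/

namespace OperatorData

variable {A : Type u} [CommRing A] (𝒟 : OperatorData.{u, v} A)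
  {K Ω : Type*} [CommRing K] [Algebra A K] [DRing 𝒟 K] [CommRing Ω] [Algebra A Ω]

/-- The map `P ↦ P^e (∑_j b^{(j)} ε_j)` for a point `b` over `K → Ω`. -/
noncomputable def twistedEval (g : K →ₐ[A] Ω) {n : ℕ} (b : Fin n × Fin (𝒟.m + 1) → Ω) :
    MvPolynomial (Fin n) K →ₐ[A] Ω ⊗[A] 𝒟.alg :=
  aevalTower ((𝒟.baseMap g).comp (DRing.e (𝒟 := 𝒟) (R := K))) fun k => ∑ j, b (k, j) ⊗ₜ[A] 𝒟.ε j

theorem twistedEval_eq_baseMap (g : K →ₐ[A] Ω) {n : ℕ} (b : Fin n × Fin (𝒟.m + 1) → Ω)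
    (P : MvPolynomial (Fin n) K) :
    𝒟.twistedEval g b P = 𝒟.baseMap (aevalTower g b) (𝒟.prolongPoly P) := by
  induction P using MvPolynomial.induction_on with
  | C c =>
    have h : (aevalTower g b).comp
        (IsScalarTower.toAlgHom A K (MvPolynomial (Fin n × Fin (𝒟.m + 1)) K)) = g := by
      ext x
      exact aevalTower_C g b x
    have h' : (𝒟.baseMap (aevalTower g b)).comp (𝒟.baseMap
        (IsScalarTower.toAlgHom A K (MvPolynomial (Fin n × Fin (𝒟.m + 1)) K))) = 𝒟.baseMap g := by
      rw [baseMap, baseMap, ← Algebra.TensorProduct.map_comp, h, AlgHom.comp_id, baseMap]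
    rw [twistedEval, aevalTower_C, prolongPoly, eval₂_C, AlgHom.comp_apply, ← h']
    rfl
  | add p q hp hq =>
    have : 𝒟.prolongPoly (p + q) = 𝒟.prolongPoly p + 𝒟.prolongPoly q := eval₂_add _ _
    rw [map_add, hp, hq, this, map_add]
  | mul_X p k hp =>
    have : 𝒟.prolongPoly (p * X k) = 𝒟.prolongPoly p * 𝒟.genericPoint K k := by
      rw [prolongPoly, eval₂_mul, eval₂_X, prolongPoly]
    rw [map_mul, hp, this, map_mul]
    simp [twistedEval, genericPoint]

theorem coeff_twistedEval (g : K →ₐ[A] Ω) {n : ℕ} (b : Fin n × Fin (𝒟.m + 1) → Ω)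
    (P : MvPolynomial (Fin n) K) (j : Fin (𝒟.m + 1)) :
    𝒟.coeff Ω j (𝒟.twistedEval g b P) = aevalTower g b (𝒟.prolongCoeff P j) := by
  rw [twistedEval_eq_baseMap, coeff_baseMap]
  rfl

theorem twistedEval_eq_zero {g : K →ₐ[A] Ω} {n : ℕ} {b : Fin n × Fin (𝒟.m + 1) → Ω}
    {I : Ideal (MvPolynomial (Fin n) K)} (h : ∀ Q ∈ 𝒟.prolongIdeal I, aevalTower g b Q = 0)
    {P : MvPolynomial (Fin n) K} (hP : P ∈ I) : 𝒟.twistedEval g b P = 0 := by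
  refine 𝒟.ext_coeff fun j => ?_
  rw [coeff_twistedEval, map_zero, h _ (Ideal.subset_span ⟨P, hP, j, rfl⟩)]

/-- Since `e` is a ring homomorphism, `P^e(e(a)) = e(P(a))`. Thus `∇ a` lies on `τ X` whenever `a`
lies on `X`, and conversely because `e` is injective. -/
theorem twistedEval_nabla [DRing 𝒟 Ω] {g : K →ₐ[A] Ω}
    (hg : ∀ x, DRing.e (𝒟 := 𝒟) (g x) = 𝒟.baseMap g (DRing.e (𝒟 := 𝒟) x)) {n : ℕ}
    (a : Fin n → Ω) (P : MvPolynomial (Fin n) K) :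
    𝒟.twistedEval g (𝒟.nabla a) P = DRing.e (𝒟 := 𝒟) (aevalTower g a P) := by
  induction P using MvPolynomial.induction_on with
  | C c => simp [twistedEval, hg]
  | add p q hp hq => rw [map_add, hp, hq, map_add, map_add]
  | mul_X p k hp =>
    rw [map_mul, hp, map_mul, map_mul, aevalTower_X, e_eq_sum_nabla, twistedEval, aevalTower_X]

end OperatorData

/-! ### The geometric axiom implies existential closedness -/

namespace LocalSplitting

variable {A : Type u} [Field A] {𝒟 : OperatorData.{u, v} A} (S : LocalSplitting.{u, v, w} 𝒟)

section

variable {K Ω : Type*} [CommRing K] [Algebra A K] [DRing 𝒟 K] [CommRing Ω] [Algebra A Ω]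

/-- On points: `π_i (P^e(b)) = P^{σ_i}(π̂_i(b))`. This translates density of `π̂_i(Y)` into
injectivity of `π_i ∘ e`, and back. -/
theorem piBase_twistedEval (g : K →ₐ[A] Ω) {n : ℕ} (b : Fin n × Fin (𝒟.m + 1) → Ω)
    (i : Fin (S.t + 1)) (P : MvPolynomial (Fin n) K) :
    S.piBase Ω i (𝒟.twistedEval g b P) =
      aevalTower g b (S.piHat K n i (map (S.σ K i : K →+* K) P)) := by
  induction P using MvPolynomial.induction_on with
  | C c =>
    rw [OperatorData.twistedEval, aevalTower_C, AlgHom.comp_apply, piBase_baseMap, map_C]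
    simp [piHat, σ_apply]
  | add p q hp hq => simp only [map_add, hp, hq]
  | mul_X p k hp =>
    simp only [map_mul, hp, map_X]
    congr 1
    rw [OperatorData.twistedEval, aevalTower_X, piHat, aeval_X, OperatorData.genericPoint]
    simp [piBase_tmul]

variable {S} in
theorem IsInversive.mem_conjIdeal_iff (h : S.IsInversive K) {n : ℕ} {i : Fin (S.t + 1)}
    {I : Ideal (MvPolynomial (Fin n) K)} {P : MvPolynomial (Fin n) K} :
    P ∈ S.conjIdeal i I ↔ ∃ Q ∈ I, map (S.σ K i : K →+* K) Q = P :=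
  Ideal.mem_map_iff_of_surjective _ (map_surjective _ (h.σ_surjective i))

/-- Each tuple `a` of an extension has a specialization `a'` in `K`: the algebraic relations over
`K` between the coordinates of `∇ a` hold for `∇ a'`. -/
theorem GeometricAxiom.exists_specialization {S : LocalSplitting.{u, v, w} 𝒟}
    {L : Type*} [CommRing L] [IsDomain L] [Algebra A L] [DRing 𝒟 L]
    (hax : S.GeometricAxiom K) (hinv : S.IsInversive K) (hL : S.InClass L)
    (f : 𝒟.lang.Embedding K L) {n : ℕ} (a : Fin n → L) :
    ∃ a' : Fin n → K, ∀ Q, aevalTower (𝒟.algHomOfEmbedding f) (𝒟.nabla a) Q = 0 →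
      eval (𝒟.nabla a') Q = 0 := by
  set g := 𝒟.algHomOfEmbedding f
  have hg : ∀ x, DRing.e (𝒟 := 𝒟) (g x) = 𝒟.baseMap g (DRing.e (𝒟 := 𝒟) x) :=
    𝒟.e_algHomOfEmbedding f
  let I := RingHom.ker (aevalTower g a)
  let J := RingHom.ker (aevalTower g (𝒟.nabla a))
  obtain ⟨a', -, h⟩ := hax n I J (RingHom.ker_isPrime _) (RingHom.ker_isPrime _)
    (Ideal.span_le.2 <| by
      rintro _ ⟨P, hP, j, rfl⟩
      change aevalTower g (𝒟.nabla a) _ = 0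
      rw [← OperatorData.coeff_twistedEval, 𝒟.twistedEval_nabla hg, RingHom.mem_ker.1 hP,
        map_zero, map_zero])
    fun i => by
      rw [PrimeSpectrum.closure_image_comap_zeroLocus]
      congr 2
      ext P
      rw [hinv.mem_conjIdeal_iff]
      -- The pullback of `Q^{σ_i}` takes the value `σ_i(Q(a))` at `∇ a`, which vanishes exactly when
      -- `Q(a)` does.
      have key : ∀ Q, S.piHat K n i (map (S.σ K i : K →+* K) Q) ∈ J ↔ Q ∈ I := fun Q => by
        change aevalTower g (𝒟.nabla a) _ = 0 ↔ aevalTower g a Q = 0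
        rw [← piBase_twistedEval, 𝒟.twistedEval_nabla hg, ← σ_apply,
          map_eq_zero_iff _ (hL.σ_injective i)]
      obtain ⟨Q, rfl⟩ := map_surjective (S.σ K i : K →+* K) (hinv.σ_surjective i) P
      constructor
      · exact fun hQ => ⟨Q, (key Q).1 hQ, rfl⟩
      · rintro ⟨Q', hQ', h⟩
        rw [← h]
        exact (key Q').2 hQ'
  exact ⟨a', h⟩

/-- The elements of `T` are listed as one tuple. Each condition on `s` is then a polynomial relation
between coordinates of its `∇`; the value of `s` outside `T` plays no role. -/
theorem GeometricAxiom.exists_isSpecialization {S : LocalSplitting.{u, v, w} 𝒟}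
    {L : Type*} [CommRing L] [IsDomain L] [Algebra A L] [DRing 𝒟 L]
    (hax : S.GeometricAxiom K) (hinv : S.IsInversive K) (hL : S.InClass L)
    (f : 𝒟.lang.Embedding K L) (T : Finset L) :
    ∃ s, 𝒟.IsSpecialization (𝒟.algHomOfEmbedding f) T s := by
  classical
  obtain ⟨a', h⟩ := hax.exists_specialization hinv hL f (fun i => (T.equivFin.symm i : L))
  set g := 𝒟.algHomOfEmbedding f
  let s : L → K := fun x => if hx : x ∈ T then a' (T.equivFin ⟨x, hx⟩) else 0
  have key : ∀ {x}, x ∈ (T : Set L) → ∃ k, a' k = s x ∧ T.equivFin.symm k = x := fun {x} hx =>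
    ⟨T.equivFin ⟨x, hx⟩, by simp [s, show x ∈ T from hx], by simp⟩
  refine ⟨s, ?_, ?_, ?_, ?_, ?_, ?_⟩
  · intro c hc
    obtain ⟨k, hk, hk'⟩ := key hc
    have := h (X (k, 0) - C c) (by simp [OperatorData.nabla, hk'])
    rw [← hk]
    simpa [OperatorData.nabla, sub_eq_zero] using this
  · intro x hx y hy hz
    obtain ⟨k, hk, hk'⟩ := key hx
    obtain ⟨l, hl, hl'⟩ := key hy
    obtain ⟨p, hp, hp'⟩ := key hz
    have := h (X (p, 0) - (X (k, 0) + X (l, 0))) (by simp [OperatorData.nabla, hk', hl', hp'])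
    rw [← hk, ← hl, ← hp]
    simpa [OperatorData.nabla, sub_eq_zero] using this
  · intro x hx y hy hz
    obtain ⟨k, hk, hk'⟩ := key hx
    obtain ⟨l, hl, hl'⟩ := key hy
    obtain ⟨p, hp, hp'⟩ := key hz
    have := h (X (p, 0) - X (k, 0) * X (l, 0)) (by simp [OperatorData.nabla, hk', hl', hp'])
    rw [← hk, ← hl, ← hp]
    simpa [OperatorData.nabla, sub_eq_zero] using this
  · intro x hx hz
    obtain ⟨k, hk, hk'⟩ := key hx
    obtain ⟨p, hp, hp'⟩ := key hz
    have := h (X (p, 0) - -X (k, 0)) (by simp [OperatorData.nabla, hk', hp'])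
    rw [← hk, ← hp]
    simpa only [OperatorData.nabla, map_sub, map_neg, eval_X, Fin.cons_zero, sub_eq_zero] using this
  · intro c x hx hz
    obtain ⟨k, hk, hk'⟩ := key hx
    obtain ⟨p, hp, hp'⟩ := key hz
    have := h (X (p, 0) - C (algebraMap A K c) * X (k, 0))
      (by simp [OperatorData.nabla, hk', hp', Algebra.smul_def])
    rw [← hk, ← hp]
    simpa [OperatorData.nabla, sub_eq_zero, Algebra.smul_def] using this
  · intro i x hx hz
    obtain ⟨k, hk, hk'⟩ := key hx
    obtain ⟨p, hp, hp'⟩ := key hz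
    have := h (X (p, 0) - X (k, i.succ)) (by simp [OperatorData.nabla, hk', hp'])
    rw [← hk, ← hp]
    simpa [OperatorData.nabla, sub_eq_zero] using this

end

variable {S} {K : Type z} [CommRing K] [Algebra A K] [DRing 𝒟 K]

theorem faithfulSMul_algebraicClosure_fractionRing (R : Type*) [CommRing R] [IsDomain R] :
    FaithfulSMul R (AlgebraicClosure (FractionRing R)) :=
  .trans R (FractionRing R) _

theorem isAlgebraic_algebraicClosure_fractionRing (R : Type*) [CommRing R] [IsDomain R] :
    Algebra.IsAlgebraic R (AlgebraicClosure (FractionRing R)) := by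
  have : Algebra.IsAlgebraic R (FractionRing R) :=
    (IsFractionRing.comap_isAlgebraic_iff (K := FractionRing R)).2 inferInstance
  exact .trans R (FractionRing R) _

/-- Each member of `𝒦` embeds in an algebraically closed field in `𝒦`. -/
theorem InClass.exists_isAlgClosed_extension (hK : S.InClass K) :
    ∃ (Ω : Type z) (_ : Field Ω) (_ : IsAlgClosed Ω) (_ : Algebra A Ω) (_ : DRing 𝒟 Ω),
      S.InClass Ω ∧ Nonempty (𝒟.lang.Embedding K Ω) := by
  have := hK.isDomain
  have := faithfulSMul_algebraicClosure_fractionRing K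
  have := isAlgebraic_algebraicClosure_fractionRing K
  obtain ⟨d, hd, f, -⟩ :=
    hK.exists_extension_of_isAlgebraic (Ω := AlgebraicClosure (FractionRing K))
  exact ⟨_, _, inferInstance, _, d, hd, ⟨f⟩⟩

theorem GeometricAxiom.isExistentiallyClosed [Nontrivial K] (hinv : S.IsInversive K)
    (hax : S.GeometricAxiom K) : S.IsExistentiallyClosed K := by
  classical
  intro L₀ _ _ _ hL₀ f₀ r n φ hφ c ⟨x₀, hx₀⟩
  -- Passing to a field supplies the inverses needed to preserve inequations.
  obtain ⟨L, _, _, _, _, hL, ⟨f₁⟩⟩ := hL₀.exists_isAlgClosed_extension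
  let f := f₁.comp f₀
  obtain ⟨T, hT⟩ := OperatorData.exists_finset_specialization_formula
    (𝒟.algHomOfEmbedding f) hφ (Sum.elim (f ∘ c) (f₁ ∘ x₀)) default
  -- The images of the parameters are included so that `s` sends them back to `c`.
  obtain ⟨s, hs⟩ := hax.exists_isSpecialization hinv hL f
    (T ∪ Finset.univ.image (f ∘ c))
  have hc : s ∘ f ∘ c = c := funext fun i =>
    hs.const (c i) (Finset.mem_coe.2 (Finset.mem_union_right _
      (Finset.mem_image_of_mem _ (Finset.mem_univ i))))
  refine ⟨s ∘ f₁ ∘ x₀, ?_⟩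
  have h := (hT s (hs.mono (by simp))).1 <| by
    have h := (hφ.realize_embedding f₁).2 hx₀
    rw [Subsingleton.elim (f₁ ∘ default) default, Sum.comp_elim] at h
    exact h
  rw [Subsingleton.elim (s ∘ default) default, Sum.comp_elim, hc] at h
  exact h

end LocalSplitting

/-! ### Existential closedness implies (I) and (II) -/

/-- `p` splits over `K`, so the roots of its image are images of elements of `K`; an element outside
the image is transcendental. -/
theorem IsAlgClosed.eval₂_ne_zero {K F : Type*} [Field K] [IsAlgClosed K] [CommRing F] [IsDomain F]
    (σ : K →+* F) {c : F} (hc : ∀ x, σ x ≠ c) {p : Polynomial K} (hp : p ≠ 0) :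
    p.eval₂ σ c ≠ 0 := by
  intro h
  have hs := IsAlgClosed.splits p
  rw [hs.eq_prod_roots, Polynomial.eval₂_mul, Polynomial.eval₂_C, Polynomial.eval₂_multiset_prod,
    mul_eq_zero, map_eq_zero, Polynomial.leadingCoeff_eq_zero, Multiset.prod_eq_zero_iff] at h
  obtain h | h := h
  · exact hp h
  · simp only [Multiset.map_map, Multiset.mem_map, Function.comp_apply, Polynomial.eval₂_sub,
      Polynomial.eval₂_X, Polynomial.eval₂_C, sub_eq_zero] at h
    obtain ⟨x, -, hx⟩ := h
    exact hc x hx.symm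

theorem IsAlgClosedField.eval₂_ne_zero {K F : Type*} [CommRing K] (hK : IsAlgClosedField K)
    [CommRing F] [IsDomain F] (σ : K →+* F) {c : F} (hc : ∀ x, σ x ≠ c) {p : Polynomial K}
    (hp : p ≠ 0) : p.eval₂ σ c ≠ 0 := by
  obtain ⟨h, h'⟩ := hK
  let := h.toField
  exact IsAlgClosed.eval₂_ne_zero σ hc hp

theorem IsField.isNoetherianRing {K : Type*} [CommRing K] (h : IsField K) : IsNoetherianRing K := by
  let := h.toField
  exact (inferInstance : IsNoetherianRing K)

theorem IsField.injective_of_nontrivial {K B : Type*} [CommRing K] (h : IsField K) [CommRing B]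
    [Nontrivial B] (f : K →+* B) : Function.Injective f := by
  let := h.toField
  exact RingHom.injective f

namespace LocalSplitting

variable {A : Type u} [Field A] {𝒟 : OperatorData.{u, v} A} {S : LocalSplitting.{u, v, w} 𝒟}
  {K : Type z} [CommRing K] [Algebra A K] [DRing 𝒟 K]

/-- Finite systems of equations that are solvable in an extension are solvable. -/
theorem IsExistentiallyClosed.exists_eval_eq_zero (hec : S.IsExistentiallyClosed K) {L : Type z}
    [CommRing L] [Algebra A L] [DRing 𝒟 L] (hL : S.InClass L) (f : 𝒟.lang.Embedding K L) {n : ℕ}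
    (s : Finset (MvPolynomial (Fin n × Fin (𝒟.m + 1)) K)) (x : Fin n → L)
    (hx : ∀ P ∈ s, aevalTower (𝒟.algHomOfEmbedding f) (𝒟.nabla x) P = 0) :
    ∃ y : Fin n → K, ∀ P ∈ s, eval (𝒟.nabla y) P = 0 := by
  obtain ⟨r, c, φ, hφ, h⟩ := 𝒟.exists_formula_realize_iff s
  obtain ⟨y, hy⟩ := hec L hL f r n φ hφ c ⟨x, (h L (𝒟.algHomOfEmbedding f) x).2 hx⟩
  exact ⟨y, (h K (AlgHom.id A K) y).1 hy⟩

theorem IsExistentiallyClosed.isAlgClosedField (hec : S.IsExistentiallyClosed K)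
    (hK : S.InClass K) : IsAlgClosedField K := by
  have := hK.isDomain
  obtain ⟨Ω, _, _, _, _, hΩ, ⟨f⟩⟩ := hK.exists_isAlgClosed_extension
  have hf : Function.Injective (𝒟.algHomOfEmbedding f) := f.injective
  have hfield : IsField K := by
    refine ⟨exists_pair_ne K, mul_comm, fun {c} hc => ?_⟩
    have hc' : 𝒟.algHomOfEmbedding f c ≠ 0 := (map_ne_zero_iff _ hf).2 hc
    obtain ⟨y, hy⟩ := hec.exists_eval_eq_zero hΩ f (n := 1) {C c * X (0, 0) - 1}
      ![(𝒟.algHomOfEmbedding f c)⁻¹] (by simp [OperatorData.nabla, hc'])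
    exact ⟨y 0, by simpa [OperatorData.nabla, sub_eq_zero] using hy⟩
  have hroot : ∀ p : Polynomial K, p.degree ≠ 0 → ∃ x, p.eval x = 0 := fun p hp => by
    obtain ⟨x, hx⟩ := IsAlgClosed.exists_root (p.map (𝒟.algHomOfEmbedding f : K →+* Ω))
      (by rwa [Polynomial.degree_map_eq_of_injective (f := (𝒟.algHomOfEmbedding f : K →+* Ω)) hf])
    obtain ⟨y, hy⟩ := hec.exists_eval_eq_zero hΩ f (n := 1) {p.eval₂ C (X (0, 0))} ![x] (by
      simp only [Finset.mem_singleton, forall_eq]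
      rw [← AlgHom.coe_toRingHom, Polynomial.hom_eval₂]
      rw [Polynomial.IsRoot, Polynomial.eval_map] at hx
      convert hx
      · ext; simp
      · simp [OperatorData.nabla])
    refine ⟨y 0, ?_⟩
    have := hy _ (Finset.mem_singleton_self _)
    rw [Polynomial.hom_eval₂] at this
    rw [Polynomial.eval, ← this]
    congr 1
    · ext; simp
    · simp [OperatorData.nabla]
  refine ⟨hfield, ?_⟩
  let := hfield.toField
  exact IsAlgClosed.of_exists_root K fun p _ hp => hroot p hp.degree_pos.ne'

theorem IsExistentiallyClosed.isInversive (hec : S.IsExistentiallyClosed K)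
    (hK : S.InClass K) : S.IsInversive K := by
  intro i c
  by_contra! hc
  have hac := hec.isAlgClosedField hK
  have := hK.isDomain
  have := hK.charZero
  let Ω := AlgebraicClosure (FractionRing (Polynomial K))
  have := faithfulSMul_algebraicClosure_fractionRing (Polynomial K)
  have := isAlgebraic_algebraicClosure_fractionRing (Polynomial K)
  have hinj : Function.Injective (algebraMap (Polynomial K) Ω) :=
    FaithfulSMul.algebraMap_injective _ _
  let g : K →ₐ[A] Ω := IsScalarTower.toAlgHom A K Ω
  have hg : ∀ k, g k = algebraMap (Polynomial K) Ω (Polynomial.C k) := fun k =>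
    IsScalarTower.algebraMap_apply K (Polynomial K) Ω k
  have hginj : Function.Injective g := fun x y h => by
    rw [hg, hg] at h
    exact Polynomial.C_injective (hinj h)
  -- `ξ` is the future `e(X)`: it prescribes `σ_i(X) = c` and `σ_k(X) = X` for every other `k`,
  -- including `k = 0`, where this is forced.
  obtain ⟨ξ, hξ⟩ := S.exists_piBase_eq (R := Ω)
    (fun k => if k = i.succ then g c else algebraMap (Polynomial K) Ω Polynomial.X)
  let e : Polynomial K →ₐ[A] Ω ⊗[A] 𝒟.alg :=
    Polynomial.aevalTower ((𝒟.baseMap g).comp (DRing.e (𝒟 := 𝒟) (R := K))) ξ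
  have heX : e Polynomial.X = ξ := by simp [e]
  have heC : ∀ k, e (Polynomial.C k) = 𝒟.baseMap g (DRing.e (𝒟 := 𝒟) k) := fun k => by simp [e]
  have h1 : ∀ k ≠ i.succ, ∀ p, S.piBase Ω k (e p) =
      algebraMap (Polynomial K) Ω (p.map (S.σ K k : K →+* K)) := fun k hk p => by
    induction p using Polynomial.induction_on' with
    | add p q hp hq => simp only [map_add, Polynomial.map_add, hp, hq]
    | monomial n a =>
      rw [← Polynomial.C_mul_X_pow_eq_monomial, map_mul, map_pow, heC, heX, map_mul, map_pow,
        piBase_baseMap, hξ, if_neg hk, ← σ_apply, hg]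
      simp
  have h2 : ∀ p, S.piBase Ω i.succ (e p) = g (p.eval₂ (S.σ K i.succ : K →+* K) c) := fun p => by
    induction p using Polynomial.induction_on' with
    | add p q hp hq => simp only [map_add, Polynomial.eval₂_add, hp, hq]
    | monomial n a =>
      rw [← Polynomial.C_mul_X_pow_eq_monomial, map_mul, map_pow, heC, heX, map_mul, map_pow,
        piBase_baseMap, hξ, if_pos rfl, ← σ_apply]
      simp
  let j : Polynomial K →ₐ[A] Ω := IsScalarTower.toAlgHom A (Polynomial K) Ω
  obtain ⟨_, hΩ, h⟩ := S.exists_dring_extending j hinj e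
    (fun p => by
      have : (S.σ K 0 : K →+* K) = RingHom.id K := RingHom.ext S.σ_zero
      rw [h1 0 (Fin.succ_ne_zero i).symm, this, Polynomial.map_id]
      rfl)
    fun k => by
      -- For `k = i` this is the transcendence of `c` over `σ_i(K)`; for other `k` the map only
      -- applies `σ_k` to coefficients.
      have hk : Function.Injective
          (((S.piBase Ω k.succ).restrictScalars A).comp e : Polynomial K →+* Ω) := by
        by_cases hki : k = i
        · subst hki
          rw [injective_iff_map_eq_zero]
          intro p hp
          by_contra hp0
          exact hac.eval₂_ne_zero (S.σ K k.succ : K →+* K) hc hp0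
            (hginj ((h2 p).symm.trans (hp.trans (map_zero g).symm)))
        · intro p q hpq
          have h := (h1 k.succ (fun h => hki (Fin.succ_injective _ h)) p).symm.trans
            (hpq.trans (h1 k.succ (fun h => hki (Fin.succ_injective _ h)) q))
          exact Polynomial.map_injective _ (hK.injective k) (hinj h)
      obtain ⟨τ, hτ⟩ := exists_ringHom_comp_eq_of_isAlgebraic (Ω₁ := Ω) _ hk
      exact ⟨τ, RingHom.congr_fun hτ⟩
  let f := 𝒟.embeddingOfAlgHom g hginj fun k => by
    rw [← heC, ← h, hg]
    rfl
  obtain ⟨y, hy⟩ := hec.exists_eval_eq_zero hΩ f (n := 1)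
    -- This is the equation `σ_i(x) = c`, written linearly in the coordinates of `∇ x`.
    {∑ k, C (algebraMap A K (S.pi i.succ (𝒟.ε k))) * X (0, k) - C c} ![j Polynomial.X] (by
      have : S.σ Ω i.succ (j Polynomial.X) = g c := by
        rw [σ_apply]
        change S.piBase Ω i.succ (DRing.e (j Polynomial.X)) = g c
        rw [h, heX, hξ, if_pos rfl]
      have h' := S.σ_eq_sum i.succ ![j Polynomial.X] 0
      simp only [Matrix.cons_val_zero] at h'
      rw [this] at h'
      have hfg : 𝒟.algHomOfEmbedding f = g := rfl
      simp [hfg, h', Algebra.smul_def])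
  refine hc (y 0) ?_
  rw [S.σ_eq_sum i.succ y 0]
  simpa [sub_eq_zero, Algebra.smul_def] using hy

end LocalSplitting

/-! ### Existential closedness implies the geometric axiom -/

namespace LocalSplitting

variable {A : Type u} [Field A] {𝒟 : OperatorData.{u, v} A} {S : LocalSplitting.{u, v, w} 𝒟}
  {K : Type z} [CommRing K] [Algebra A K] [DRing 𝒟 K]

/-- If `π̂_i(Y)` is dense in `X^{σ_i}`, then `X^{σ_i}` is defined by the polynomials whose
pullback along `π̂_i` vanishes on `Y`. -/
theorem IsInversive.piHat_map_mem_iff (hinv : S.IsInversive K) (hK : S.InClass K) {n : ℕ}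
    {I : Ideal (MvPolynomial (Fin n) K)} {J : Ideal (MvPolynomial (Fin n × Fin (𝒟.m + 1)) K)}
    (hI : I.IsPrime) (hJ : J.IsPrime) {i : Fin (S.t + 1)}
    (h : closure (PrimeSpectrum.comap (S.piHat K n i).toRingHom '' PrimeSpectrum.zeroLocus J) =
      PrimeSpectrum.zeroLocus (S.conjIdeal i I : Set (MvPolynomial (Fin n) K)))
    (P : MvPolynomial (Fin n) K) :
    S.piHat K n i (map (S.σ K i : K →+* K) P) ∈ J ↔ P ∈ I := by
  rw [PrimeSpectrum.closure_image_comap_zeroLocus, PrimeSpectrum.zeroLocus_eq_iff,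
    (hJ.comap _).radical] at h
  change map (S.σ K i : K →+* K) P ∈ J.comap (S.piHat K n i).toRingHom ↔ _
  rw [h]
  constructor
  -- Density only identifies radicals; injectivity of `σ_i` on coefficients and primality of `I`
  -- remove the power.
  · rintro ⟨k, hk⟩
    obtain ⟨Q, hQ, hQP⟩ := hinv.mem_conjIdeal_iff.1 hk
    rw [← map_pow] at hQP
    rw [map_injective _ (hK.σ_injective i) hQP] at hQ
    exact hI.mem_of_pow_mem k hQ
  · exact fun hP => Ideal.le_radical (hinv.mem_conjIdeal_iff.2 ⟨P, hP, rfl⟩)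

theorem IsExistentiallyClosed.geometricAxiom (hec : S.IsExistentiallyClosed K)
    (hK : S.InClass K) : S.GeometricAxiom K := by
  intro n I J hI hJ hIJ hdens
  obtain ⟨hfield, -⟩ := hec.isAlgClosedField hK
  have hinv := hec.isInversive hK
  have := hK.isDomain
  have := hK.charZero
  have := hfield.isNoetherianRing
  have : CharZero A := (algebraMap A K).charZero
  let R := MvPolynomial (Fin n) K ⧸ I
  let B := MvPolynomial (Fin n × Fin (𝒟.m + 1)) K ⧸ J
  let Ω := AlgebraicClosure (FractionRing B)
  have : CharZero R := charZero_of_injective_algebraMap (algebraMap A R).injective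
  have : FaithfulSMul K R := (faithfulSMul_iff_algebraMap_injective K R).2
    (hfield.injective_of_nontrivial _)
  have : FaithfulSMul K B := (faithfulSMul_iff_algebraMap_injective K B).2
    (hfield.injective_of_nontrivial _)
  have : FaithfulSMul B Ω := faithfulSMul_algebraicClosure_fractionRing B
  have : Algebra.IsAlgebraic B Ω := isAlgebraic_algebraicClosure_fractionRing B
  have hfin : Algebra.trdeg K Ω < Cardinal.aleph0 := by
    rw [← trdeg_add_eq K B (A := Ω), trdeg_eq_zero (R := B) (A := Ω), add_zero]
    exact trdeg_lt_aleph0_of_finiteType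
  let g : K →ₐ[A] Ω := IsScalarTower.toAlgHom A K Ω
  have hginj : Function.Injective g := hfield.injective_of_nontrivial (g : K →+* Ω)
  -- The generic point of `Y`. Since `Y ⊆ τ X`, the map `P ↦ P^e(b)` factors through `R`.
  let b : Fin n × Fin (𝒟.m + 1) → Ω := fun p => algebraMap B Ω (Ideal.Quotient.mk J (X p))
  have hb : ∀ Q, aevalTower g b Q = algebraMap B Ω (Ideal.Quotient.mk J Q) := fun Q => by
    induction Q using MvPolynomial.induction_on with
    | C c => exact (aevalTower_C g b c).trans (IsScalarTower.algebraMap_apply K B Ω c)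
    | add p q hp hq => rw [map_add, hp, hq, map_add, map_add]
    | mul_X p k hp => rw [map_mul, hp, map_mul, map_mul, aevalTower_X]
  have hb0 : ∀ Q, aevalTower g b Q = 0 ↔ Q ∈ J := fun Q => by
    rw [hb, map_eq_zero_iff _ (FaithfulSMul.algebraMap_injective B Ω), Ideal.Quotient.eq_zero_iff_mem]
  let e : R →ₐ[A] Ω ⊗[A] 𝒟.alg := Ideal.Quotient.liftₐ I (𝒟.twistedEval g b) fun P hP =>
    𝒟.twistedEval_eq_zero (fun Q hQ => (hb0 Q).2 (hIJ hQ)) hP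
  let s : Fin (S.t + 1) → R →ₐ[A] Ω := fun i => ((S.piBase Ω i).restrictScalars A).comp e
  have hs : ∀ i, Function.Injective (s i) := fun i => by
    rw [injective_iff_map_eq_zero]
    intro r hr
    obtain ⟨P, rfl⟩ := Ideal.Quotient.mk_surjective r
    have h : S.piBase Ω i (𝒟.twistedEval g b P) = 0 := hr
    rw [piBase_twistedEval, hb0, hinv.piHat_map_mem_iff hK hI hJ (hdens i)] at h
    exact Ideal.Quotient.eq_zero_iff_mem.2 h
  have heK : ∀ k, e (algebraMap K R k) = 𝒟.baseMap g (DRing.e (𝒟 := 𝒟) k) := fun k => by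
    change 𝒟.twistedEval g b (C k) = _
    rw [OperatorData.twistedEval, aevalTower_C]
    rfl
  have hsK : ∀ i k, s i (algebraMap K R k) = g (S.σ K i k) := fun i k => by
    change S.piBase Ω i (e _) = _
    rw [heK, piBase_baseMap, σ_apply]
  have hs0 : ∀ k, s 0 (algebraMap K R k) = g k := fun k => by rw [hsK, σ_zero]
  -- `R` is viewed inside `Ω` by `s 0`, injective by density at index `0`. On `K` the maps `s
  -- i.succ` and `s 0` differ by the automorphism `σ_i`, so the transcendence degree count applies.
  obtain ⟨_, hΩ, h⟩ := S.exists_dring_extending (s 0) (hs 0) e (fun _ => rfl) fun i => by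
    obtain ⟨τ, hτ⟩ := exists_ringHom_comp_eq hfin (s 0 : R →+* Ω) (hs 0) hs0
      (s i.succ : R →+* Ω) (hs i.succ)
      (RingEquiv.ofBijective (S.σ K i.succ : K →+* K)
        ⟨hK.σ_injective i.succ, hinv.σ_surjective i.succ⟩) (RingHom.id Ω) (hsK i.succ)
    exact ⟨τ, RingHom.congr_fun hτ⟩
  let f := 𝒟.embeddingOfAlgHom g hginj fun k => by
    rw [← heK, ← h, hs0]
  have hx : 𝒟.nabla (fun k => s 0 (Ideal.Quotient.mk I (X k))) = b := funext fun ⟨k, j⟩ => by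
    rw [OperatorData.nabla_apply]
    change 𝒟.coeff Ω j (DRing.e (s 0 _)) = _
    rw [h]
    change 𝒟.coeff Ω j (𝒟.twistedEval g b (X k)) = _
    rw [OperatorData.twistedEval, aevalTower_X, OperatorData.coeff_sum]
  -- By Hilbert's basis theorem, membership of `∇ y` in `Y` is a finite system of equations.
  obtain ⟨G, hG⟩ := (isNoetherianRing_iff_ideal_fg _).1
    (inferInstance : IsNoetherianRing (MvPolynomial (Fin n × Fin (𝒟.m + 1)) K)) J
  obtain ⟨y, hy⟩ := hec.exists_eval_eq_zero hΩ f G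
    (fun k => s 0 (Ideal.Quotient.mk I (X k))) fun P hP => by
      rw [hx]
      exact (hb0 P).2 (hG ▸ Ideal.subset_span hP)
  have hyJ : J ≤ RingHom.ker (eval (𝒟.nabla y)) := hG ▸ Ideal.span_le.2 hy
  refine ⟨y, fun P hP => ?_, fun Q hQ => hyJ hQ⟩
  have h0 := 𝒟.twistedEval_eq_zero (g := AlgHom.id A K) (b := 𝒟.nabla y)
    (fun Q hQ => hyJ (hIJ hQ)) hP
  have hid : ∀ x, DRing.e (𝒟 := 𝒟) (AlgHom.id A K x) =
      𝒟.baseMap (AlgHom.id A K) (DRing.e (𝒟 := 𝒟) x) := fun x =>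
    𝒟.ext_coeff fun j => by rw [OperatorData.coeff_baseMap]; rfl
  rw [𝒟.twistedEval_nabla hid, map_eq_zero_iff _ 𝒟.e_injective] at h0
  exact h0

end LocalSplitting

theorem mainTheorem2 {A : Type u} [Field A] (𝒟 : OperatorData.{u, v} A)
    (S : LocalSplitting.{u, v, w} 𝒟)
    (K : Type z) [CommRing K] [Algebra A K] [DRing 𝒟 K] (hK : S.InClass K) :
    S.IsExistentiallyClosed K ↔
      IsAlgClosedField K ∧ S.IsInversive K ∧ S.GeometricAxiom K := by
  have := hK.isDomain
  exact ⟨fun h => ⟨h.isAlgClosedField hK, h.isInversive hK, h.geometricAxiom hK⟩,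
    fun ⟨_, hinv, hax⟩ => hax.isExistentiallyClosed hinv⟩
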